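/- Let $d\ge 3$ and let $Q_d$ be the $d$-dimensional hypercube: its vertex set is $\{0,1\}^d$, and two vertices are adjacent if and only if they differ in exactly one coordinate. Let $L(Q_d)$ be its line graph; its vertices are the $d2^{d-1}$ edges of $Q_d$, and two of them are adjacent if and only if they are distinct and share an endpoint. A family of binary observables with anti-commutativity graph $G=(V,E)$ is a family $(A_v)_{v\in V}$ of Hermitian matrices on some $\mathbb{C}^m$, $m\ge 1$, with $A_v^2=\mathbb{1}$, such that $A_vA_w=-A_wA_v$ if and only if $\{v,w\}\in E$, and $A_vA_w=A_wA_v$ whenever $\{v,w\}\notin E$. For $\eta\in[0,1]$ let $A_v^\eta=\eta A_v+(1-\eta)\frac{\operatorname{tr}A_v}{m}\mathbb{1}$, with effects $\mathsf M_v^\eta(\pm)=\frac12(\mathbb{1}\pm A_v^\eta)$. The noisy family is jointly measurable if there are positive semidefinite matrices $\mathsf E(a)$, $a\in\{\pm1\}^V$, with $\sum_a\mathsf E(a)=\mathbb{1}$ and $\mathsf M_v^\eta(\pm)=\sum_{a:\,a_v=\pm1}\mathsf E(a)$ for all $v\in V$. The incompatibility robustness $\eta(G)$ is the largest $\eta\in[0,1]$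 for which the noisy family is jointly measurable. Then families of binary observables with anti-commutativity graph $L(Q_d)$ exist, and for every such family the maximum defining the robustness is attained and has the same value $$\eta\big(L(Q_d)\big)=\frac{1}{\sqrt d}.$$ Moreover, the maximum skew-energy of $Q_d$ is $2^d\sqrt d$, and it is attained by some orientation. Here the skew-energy of an orientation is the sum of the absolute values of the eigenvalues, with multiplicity, of its skew-adjacency matrix $S$, where $S_{uv}=1$ if $u\to v$, $S_{uv}=-1$ if $v\to u$, and $S_{uv}=0$ otherwise. -/

import Mathlib

open scoped ComplexOrder

/-! ### Graphs: hypercube, orientations, skew-energy -/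

/-- The `d`-dimensional hypercube: vertices `{0,1}^d`, two vertices being adjacent iff they differ
in exactly one coordinate. -/
def hypercube (d : ℕ) : SimpleGraph (Fin d → Bool) where
  Adj x y := hammingDist x y = 1
  symm := ⟨fun x y h => by rwa [hammingDist_comm]⟩
  loopless := ⟨fun x h => by simp at h⟩

instance hypercube.instDecidableRelAdj (d : ℕ) : DecidableRel (hypercube d).Adj :=
  fun x y => inferInstanceAs (Decidable (hammingDist x y = 1))

/-- An orientation of a simple graph: every edge `{u, v}` receives exactly one of the two
directions `u → v`, `v → u`, and nothing else is directed. -/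
structure GraphOrientation {V : Type*} (G : SimpleGraph V) where
  /-- `dir u v` means `u → v`. -/
  dir : V → V → Prop
  adj_of_dir : ∀ u v, dir u v → G.Adj u v
  dir_or_dir : ∀ u v, G.Adj u v → dir u v ∨ dir v u
  not_both : ∀ u v, dir u v → ¬ dir v u

open Classical in
/-- The skew-adjacency matrix of an oriented graph: `1` if `u → v`, `-1` if `v → u`, else `0`
(with entries regarded as complex numbers). -/
noncomputable def skewAdjacency {V : Type*} {G : SimpleGraph V} (σ : GraphOrientation G) :
    Matrix V V ℂ :=
  Matrix.of fun u v => if σ.dir u v then 1 else if σ.dir v u then -1 else 0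

/-- The skew-energy of an oriented graph: the sum of the absolute values of the (complex)
eigenvalues of the skew-adjacency matrix, counted with algebraic multiplicity. -/
noncomputable def skewEnergy {V : Type*} [Fintype V] [DecidableEq V] {G : SimpleGraph V}
    (σ : GraphOrientation G) : ℝ :=
  ((skewAdjacency σ).charpoly.roots.map fun z : ℂ => ‖z‖).sum

/-! ### Measurements on a finite-dimensional Hilbert space `ℂ^ι` -/

/-- A POVM with finite outcome set `Ω`. -/
def IsPOVM {ι Ω : Type*} [Fintype ι] [DecidableEq ι] [Fintype Ω]
    (M : Ω → Matrix ι ι ℂ) : Prop :=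
  (∀ a, (M a).PosSemidef) ∧ ∑ a, M a = 1

/-- A family of POVMs `M v` (`v : V`) with common outcome set `Ω` is jointly measurable if there is
a parent POVM with outcomes in `V → Ω` whose `v`-th marginal is `M v`, for every `v`. -/
def IsJointlyMeasurable {ι V Ω : Type*} [Fintype ι] [DecidableEq ι] [Fintype V] [DecidableEq V]
    [Fintype Ω] [DecidableEq Ω] (M : V → Ω → Matrix ι ι ℂ) : Prop :=
  ∃ E : (V → Ω) → Matrix ι ι ℂ, IsPOVM E ∧
    ∀ (v : V) (s : Ω), M v s = ∑ a : V → Ω with a v = s, E a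

/-- `A` is a family of binary observables (Hermitian, squaring to the identity), indexed by the
vertices of `G`, whose anti-commutativity graph is `G`: two of them anti-commute iff they are
adjacent, and non-adjacent ones commute. -/
structure HasAnticommutativityGraph {ι V : Type*} [Fintype ι] [DecidableEq ι]
    (G : SimpleGraph V) (A : V → Matrix ι ι ℂ) : Prop where
  isHermitian : ∀ v, (A v).IsHermitian
  mul_self : ∀ v, A v * A v = 1
  adj_iff : ∀ v w, G.Adj v w ↔ A v * A w = -(A w * A v)
  commute : ∀ v w, ¬ G.Adj v w → A v * A w = A w * A v

/-- The noisy version `A^η = η A + (1 - η) (tr A / dim) 1` of an observable. -/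
noncomputable def noisyObservable {ι : Type*} [Fintype ι] [DecidableEq ι] (η : ℝ)
    (A : Matrix ι ι ℂ) : Matrix ι ι ℂ :=
  (η : ℂ) • A + ((A.trace / (Fintype.card ι : ℂ)) * (1 - (η : ℂ))) • (1 : Matrix ι ι ℂ)

/-- The effects `(1 ± A^η) / 2` of the noisy observable `A^η`, indexed by the outcomes `±1`. -/
noncomputable def noisyEffect {ι : Type*} [Fintype ι] [DecidableEq ι] (η : ℝ)
    (A : Matrix ι ι ℂ) (s : ℤˣ) : Matrix ι ι ℂ :=
  (1 / 2 : ℂ) • (1 + ((s : ℤ) : ℂ) • noisyObservable η A)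

/-- An observable that anti-commutes with an involution is traceless, and its noisy effects are
`(1 ± η A) / 2`. -/
theorem noisyEffect_eq_of_anticommute {ι : Type*} [Fintype ι] [DecidableEq ι] (η : ℝ)
    (A B : Matrix ι ι ℂ) (hB : B * B = 1) (h : A * B = -(B * A)) (s : ℤˣ) :
    noisyEffect η A s = (1 / 2 : ℂ) • (1 + ((s : ℤ) : ℂ) • ((η : ℂ) • A)) := by
  have h1 : A.trace = -A.trace := by
    calc A.trace = (A * B * B).trace := by rw [Matrix.mul_assoc, hB, Matrix.mul_one]
      _ = -(B * A * B).trace := by rw [h, Matrix.neg_mul, Matrix.trace_neg]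
      _ = -A.trace := by rw [Matrix.trace_mul_comm, ← Matrix.mul_assoc, hB, Matrix.one_mul]
  have h2 : A.trace = 0 := self_eq_neg.mp h1
  simp [noisyEffect, noisyObservable, h2]

/-- The noise levels `η ∈ [0, 1]` at which the noisy versions of all the observables `A v` are
jointly measurable. -/
def jointlyMeasurableLevels {ι V : Type*} [Fintype ι] [DecidableEq ι] [Fintype V] [DecidableEq V]
    (A : V → Matrix ι ι ℂ) : Set ℝ :=
  {η | η ∈ Set.Icc (0 : ℝ) 1 ∧ IsJointlyMeasurable fun v => noisyEffect η (A v)}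

/-- `r` is the incompatibility robustness `η(G)` of the graph `G`: families of binary observables
on a nonzero finite-dimensional Hilbert space with anti-commutativity graph `G` exist, and for each
of them `r` is the maximum of the `η ∈ [0, 1]` at which the noisy family is jointly measurable. -/
def IsIncompatibilityRobustness {V : Type*} [Fintype V] [DecidableEq V] (G : SimpleGraph V)
    (r : ℝ) : Prop :=
  (∃ m : ℕ, 0 < m ∧ ∃ A : V → Matrix (Fin m) (Fin m) ℂ, HasAnticommutativityGraph G A) ∧
  ∀ m : ℕ, 0 < m → ∀ A : V → Matrix (Fin m) (Fin m) ℂ, HasAnticommutativityGraph G A →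
    IsGreatest (jointlyMeasurableLevels A) r

/-! Upper bound on the robustness: the `d` edges at one vertex of `Q_d` are pairwise adjacent in the
line graph, so they carry pairwise anti-commuting observables. Every signed sum `H = ∑ ±A_i` of
these satisfies `H² = d`, hence `H ≤ √d`. Pairing a parent POVM with the signed sums and taking
traces gives `d η ≤ √d` (`le_of_isJointlyMeasurable_of_anticomm`).

Lower bound: let `B` be a second family with the same graph. The operators `A_v ⊗ B_v` commute,
since the two signs cancel, so they are measured jointly by their common spectral projections.
Compressing to `ℂ^ι ⊗ e_k` turns `A_v ⊗ B_v` into `⟨e_k, B_v e_k⟩ A_v`, which is a parent POVM at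
level `η` as soon as all these expectations equal `η` (`isJointlyMeasurable_of_reference`). It
remains to find such a `B` with expectations `1/√d`.

The source is a signing `S` of the cube with `Sᵀ = -S` and `S² = -d`, so that `S/√d` is orthogonal.
Take two mutually anti-commuting sets of Majorana operators indexed by the vertices, rotate the
second by `S/√d`, and attach to each edge, ordered from even to odd endpoint, a signed product of
one operator from each set. Two products anti-commute iff they share exactly one factor, which is
line graph adjacency; the vacuum expectation is `S_uv²/√d = 1/√d`.

The same `S` settles the skew-energy: Cauchy–Schwarz bounds the sum of `|λ|` by `√(2^d · d 2^d)`,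
and equality holds because `S² = -d` makes all `|λ|` equal. -/

open Finset

/-! ### Signed bit flips -/

section SignedFlip

variable {α : Type*} [DecidableEq α]

/-- The configuration obtained from `x` by flipping the bit at `i`. -/
def flipAt (i : α) (x : α → Bool) : α → Bool := Function.update x i (!x i)

theorem flipAt_flipAt (i : α) (x : α → Bool) : flipAt i (flipAt i x) = x := by
  simp only [flipAt, Function.update_self, Function.update_idem, Bool.not_not,
    Function.update_eq_self]

theorem flipAt_comm (i j : α) (x : α → Bool) :
    flipAt i (flipAt j x) = flipAt j (flipAt i x) := by
  rcases eq_or_ne i j with rfl | h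
  · rfl
  · simp only [flipAt, Function.update_of_ne h, Function.update_of_ne h.symm,
      Function.update_comm h]

theorem eq_flipAt_iff (i : α) (x y : α → Bool) : y = flipAt i x ↔ x = flipAt i y :=
  ⟨fun h => by rw [h, flipAt_flipAt], fun h => by rw [h, flipAt_flipAt]⟩

theorem flipAt_left_injective (x : α → Bool) : Function.Injective fun i => flipAt i x := by
  intro i j h
  by_contra hij
  have := congrFun h i
  simp [flipAt, hij] at this

/-- The sign `(-1)^(number of set bits of x in s)`. -/
def bitSign (s : Finset α) (x : α → Bool) : ℂ := ∏ i ∈ s, if x i then -1 else 1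

theorem bitSign_eq (s : Finset α) (x : α → Bool) : bitSign s x = 1 ∨ bitSign s x = -1 := by
  unfold bitSign
  induction s using Finset.induction_on with
  | empty => simp
  | insert a s ha ih =>
    rw [Finset.prod_insert ha]
    rcases ih with h | h <;> rw [h] <;> cases x a <;> simp

theorem bitSign_mul_self (s : Finset α) (x : α → Bool) : bitSign s x * bitSign s x = 1 := by
  rcases bitSign_eq s x with h | h <;> simp [h]

theorem star_bitSign (s : Finset α) (x : α → Bool) : star (bitSign s x) = bitSign s x := by
  rcases bitSign_eq s x with h | h <;> simp [h]

theorem bitSign_flipAt (s : Finset α) (i : α) (x : α → Bool) :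
    bitSign s (flipAt i x) = (if i ∈ s then -1 else 1) * bitSign s x := by
  unfold bitSign
  split_ifs with h
  · rw [← Finset.mul_prod_erase s _ h, ← Finset.mul_prod_erase s (fun j => if x j then _ else _) h,
      ← mul_assoc]
    congr 1
    · cases hx : x i <;> simp [flipAt, hx]
    · refine Finset.prod_congr rfl fun j hj => ?_
      simp [flipAt, Finset.ne_of_mem_erase hj]
  · rw [one_mul]
    refine Finset.prod_congr rfl fun j hj => ?_
    have : j ≠ i := fun e => h (e ▸ hj)
    simp [flipAt, this]

variable [Fintype α]

/-- The matrix that flips the bit at `i`, with the sign of the bits in `s`. -/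
def signedFlip (i : α) (s : Finset α) : Matrix (α → Bool) (α → Bool) ℂ :=
  Matrix.of fun x y => if y = flipAt i x then bitSign s x else 0

theorem conjTranspose_signedFlip (i : α) (s : Finset α) :
    (signedFlip i s).conjTranspose = (if i ∈ s then -1 else 1 : ℂ) • signedFlip i s := by
  ext x y
  simp only [signedFlip, Matrix.conjTranspose_apply, Matrix.of_apply, Matrix.smul_apply,
    smul_eq_mul, eq_flipAt_iff i y x]
  by_cases h : y = flipAt i x
  · rw [if_pos h, if_pos h, star_bitSign, h, bitSign_flipAt]
  · simp [h]

theorem signedFlip_mul_apply (i j : α) (s t : Finset α) (x y : α → Bool) :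
    (signedFlip i s * signedFlip j t) x y =
      if y = flipAt j (flipAt i x) then
        (if i ∈ t then -1 else 1) * (bitSign s x * bitSign t x) else 0 := by
  simp only [signedFlip, Matrix.mul_apply, Matrix.of_apply, ite_mul, zero_mul,
    Finset.sum_ite_eq', Finset.mem_univ, if_true, bitSign_flipAt]
  split_ifs <;> ring

/-- Both orders flip the same two bits. Each order picks up a sign when the first flipped bit lies
in the other sign set; the hypothesis says that this happens for exactly one order. The sets `Iio i`
and `Iic i` used below are Jordan–Wigner strings. -/
theorem signedFlip_anticomm {i j : α} {s t : Finset α} (h : i ∈ t ↔ j ∉ s) :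
    signedFlip i s * signedFlip j t = -(signedFlip j t * signedFlip i s) := by
  ext x y
  rw [Matrix.neg_apply, signedFlip_mul_apply, signedFlip_mul_apply, flipAt_comm]
  by_cases hj : j ∈ s <;> by_cases hy : y = flipAt i (flipAt j x) <;> simp_all [mul_comm]

theorem signedFlip_mul_self (i : α) (s : Finset α) :
    signedFlip i s * signedFlip i s = (if i ∈ s then -1 else 1 : ℂ) • 1 := by
  ext x y
  rw [signedFlip_mul_apply, flipAt_flipAt, bitSign_mul_self]
  simp [Matrix.one_apply, eq_comm]

end SignedFlip

/-! ### Sums of anticommuting matrices -/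

/-- Clifford relation in polarised form: mixed terms cancel in pairs and only the diagonal survives.
It yields the squares of signed sums and also the relations among the rotated Majorana operators. -/
theorem sum_smul_mul_sum_smul_of_anticomm {α R : Type*} [Fintype α] [DecidableEq α] [Ring R]
    [Algebra ℂ R] {A : α → R} {ε : ℂ} (hsq : ∀ i, A i * A i = ε • 1)
    (hA : ∀ i j, i ≠ j → A i * A j = -(A j * A i)) (c c' : α → ℂ) :
    (∑ i, c i • A i) * (∑ i, c' i • A i) + (∑ i, c' i • A i) * (∑ i, c i • A i) =
      (2 * ε * ∑ i, c i * c' i) • (1 : R) := by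
  have key : ∀ i j, (c i • A i) * (c' j • A j) + (c' j • A j) * (c i • A i) =
      if i = j then (2 * ε * (c i * c' i)) • (1 : R) else 0 := by
    intro i j
    simp only [smul_mul_smul_comm]
    split_ifs with h
    · subst h
      rw [hsq, smul_smul, smul_smul, ← add_smul]
      congr 1; ring
    · rw [hA i j h, smul_neg, mul_comm (c' j), neg_add_cancel]
  rw [Finset.sum_mul_sum, Finset.sum_mul_sum, Finset.sum_comm (s := univ) (t := univ)
    (f := fun i j => (c' i • A i) * (c j • A j)), ← Finset.sum_add_distrib]
  simp_rw [← Finset.sum_add_distrib, key]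
  simp [Finset.mul_sum, Finset.sum_smul]

theorem sum_smul_sq_of_anticomm {α R : Type*} [Fintype α] [DecidableEq α] [Ring R]
    [Algebra ℂ R] {A : α → R} {ε : ℂ} (hsq : ∀ i, A i * A i = ε • 1)
    (hA : ∀ i j, i ≠ j → A i * A j = -(A j * A i)) (c : α → ℂ) :
    (∑ i, c i • A i) * (∑ i, c i • A i) = (ε * ∑ i, c i * c i) • (1 : R) := by
  have h := sum_smul_mul_sum_smul_of_anticomm hsq hA c c
  rw [← two_smul ℂ, mul_assoc, ← smul_smul] at h
  exact (smul_right_injective R (two_ne_zero' ℂ)) h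

/-! ### The hypercube -/

theorem hypercube_adj_iff {d : ℕ} (x y : Fin d → Bool) :
    (hypercube d).Adj x y ↔ ∃ i, y = flipAt i x := by
  change hammingDist x y = 1 ↔ _
  rw [hammingDist, Finset.card_eq_one]
  refine exists_congr fun i => ?_
  simp only [Finset.ext_iff, Finset.mem_filter, Finset.mem_univ, true_and, Finset.mem_singleton,
    funext_iff, flipAt, Function.update_apply]
  refine forall_congr' fun k => ?_
  by_cases h : k = i
  · subst h; cases x k <;> cases y k <;> simp
  · simp [h, eq_comm]

theorem hypercube_degree {d : ℕ} (x : Fin d → Bool) : (hypercube d).degree x = d := by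
  have : (hypercube d).neighborFinset x = Finset.univ.image fun i => flipAt i x := by
    ext y
    simp [hypercube_adj_iff, eq_comm]
  rw [← SimpleGraph.card_neighborFinset_eq_degree, this,
    Finset.card_image_of_injective _ (flipAt_left_injective x)]
  simp

theorem card_edgeSet_hypercube {d : ℕ} (hd : 1 ≤ d) :
    Fintype.card (hypercube d).edgeSet = d * 2 ^ (d - 1) := by
  have h := (hypercube d).sum_degrees_eq_twice_card_edges
  simp only [hypercube_degree, Finset.sum_const, Finset.card_univ, Fintype.card_fun,
    Fintype.card_bool, Fintype.card_fin, smul_eq_mul] at h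
  rw [← SimpleGraph.edgeFinset_card]
  obtain ⟨k, rfl⟩ : ∃ k, d = k + 1 := ⟨d - 1, by omega⟩
  rw [pow_succ] at h
  simp only [Nat.add_sub_cancel]
  linarith

/-- Huang's signed adjacency matrix of the hypercube, in its skew-symmetric form. -/
def hypercubeSkew (d : ℕ) : Matrix (Fin d → Bool) (Fin d → Bool) ℂ :=
  ∑ i, signedFlip i (Finset.Iic i)

theorem signedFlip_Iic_anticomm {d : ℕ} {i j : Fin d} (h : i ≠ j) :
    signedFlip i (Finset.Iic i) * signedFlip j (Finset.Iic j) =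
      -(signedFlip j (Finset.Iic j) * signedFlip i (Finset.Iic i)) :=
  signedFlip_anticomm (by simp only [Finset.mem_Iic]; omega)

theorem signedFlip_Iio_anticomm {d : ℕ} {i j : Fin d} (h : i ≠ j) :
    signedFlip i (Finset.Iio i) * signedFlip j (Finset.Iio j) =
      -(signedFlip j (Finset.Iio j) * signedFlip i (Finset.Iio i)) :=
  signedFlip_anticomm (by simp only [Finset.mem_Iio]; omega)

theorem signedFlip_Iio_Iic_anticomm {d : ℕ} (i j : Fin d) :
    signedFlip i (Finset.Iio i) * signedFlip j (Finset.Iic j) =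
      -(signedFlip j (Finset.Iic j) * signedFlip i (Finset.Iio i)) :=
  signedFlip_anticomm (by simp only [Finset.mem_Iio, Finset.mem_Iic]; omega)

theorem signedFlip_Iic_mul_self {d : ℕ} (i : Fin d) :
    signedFlip i (Finset.Iic i) * signedFlip i (Finset.Iic i) = (-1 : ℂ) • 1 := by
  rw [signedFlip_mul_self]; simp

theorem hypercubeSkew_mul_self (d : ℕ) :
    hypercubeSkew d * hypercubeSkew d = (-d : ℂ) • 1 := by
  have := sum_smul_sq_of_anticomm (signedFlip_Iic_mul_self (d := d))
    (fun i j h => signedFlip_Iic_anticomm h) (fun _ => 1)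
  simpa [hypercubeSkew] using this

theorem conjTranspose_hypercubeSkew (d : ℕ) :
    (hypercubeSkew d).conjTranspose = -hypercubeSkew d := by
  simp [hypercubeSkew, Matrix.conjTranspose_sum, conjTranspose_signedFlip]

theorem hypercubeSkew_apply_flipAt {d : ℕ} (i : Fin d) (x : Fin d → Bool) :
    hypercubeSkew d x (flipAt i x) = bitSign (Finset.Iic i) x := by
  simp [hypercubeSkew, Matrix.sum_apply, signedFlip, (flipAt_left_injective x).eq_iff]

theorem hypercubeSkew_apply_of_not_adj {d : ℕ} {x y : Fin d → Bool}
    (h : ¬ (hypercube d).Adj x y) : hypercubeSkew d x y = 0 := by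
  rw [hypercube_adj_iff] at h
  push Not at h
  simp [hypercubeSkew, Matrix.sum_apply, signedFlip, h]

theorem hypercubeSkew_apply_of_adj {d : ℕ} {x y : Fin d → Bool}
    (h : (hypercube d).Adj x y) : hypercubeSkew d x y = 1 ∨ hypercubeSkew d x y = -1 := by
  obtain ⟨i, rfl⟩ := (hypercube_adj_iff x y).1 h
  rw [hypercubeSkew_apply_flipAt]
  exact bitSign_eq _ _

theorem star_hypercubeSkew_apply {d : ℕ} (x y : Fin d → Bool) :
    star (hypercubeSkew d x y) = hypercubeSkew d x y := by
  by_cases h : (hypercube d).Adj x y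
  · rcases hypercubeSkew_apply_of_adj h with h | h <;> simp [h]
  · simp [hypercubeSkew_apply_of_not_adj h]

theorem hypercubeSkew_swap {d : ℕ} (x y : Fin d → Bool) :
    hypercubeSkew d y x = -hypercubeSkew d x y := by
  have := congrFun₂ (conjTranspose_hypercubeSkew d) x y
  rwa [Matrix.conjTranspose_apply, star_hypercubeSkew_apply, Matrix.neg_apply] at this

/-! ### Skew-energy -/

/-- The orientation of the hypercube given by the signs of `hypercubeSkew`. -/
def hypercubeOrientation (d : ℕ) : GraphOrientation (hypercube d) where
  dir x y := hypercubeSkew d x y = 1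
  adj_of_dir x y h := by
    by_contra hn
    simp [hypercubeSkew_apply_of_not_adj hn] at h
  dir_or_dir x y h := by
    rw [hypercubeSkew_swap x y]
    rcases hypercubeSkew_apply_of_adj h with h | h <;> simp [h]
  not_both x y h := by
    rw [hypercubeSkew_swap x y, h]
    norm_num

theorem skewAdjacency_hypercubeOrientation (d : ℕ) :
    skewAdjacency (hypercubeOrientation d) = hypercubeSkew d := by
  ext x y
  simp only [skewAdjacency, hypercubeOrientation, Matrix.of_apply, hypercubeSkew_swap x y]
  by_cases h : (hypercube d).Adj x y
  · rcases hypercubeSkew_apply_of_adj h with h | h <;> simp [h]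
    norm_num
  · simp [hypercubeSkew_apply_of_not_adj h]

section SkewEnergy

variable {n : Type*} [Fintype n] [DecidableEq n]

theorem Matrix.exists_mulVec_eq_smul_of_mem_roots_charpoly {S : Matrix n n ℂ} {z : ℂ}
    (hz : z ∈ S.charpoly.roots) : ∃ v : n → ℂ, v ≠ 0 ∧ S.mulVec v = z • v := by
  have h : S.charpoly.eval z = 0 := Polynomial.isRoot_of_mem_roots hz
  rw [Matrix.eval_charpoly] at h
  obtain ⟨v, hv, h⟩ := Matrix.exists_mulVec_eq_zero_iff.2 h
  refine ⟨v, hv, ?_⟩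
  rw [Matrix.sub_mulVec, sub_eq_zero] at h
  rw [← h]
  simp [Matrix.scalar_apply, ← Matrix.smul_one_eq_diagonal, Matrix.smul_mulVec]

theorem Matrix.card_roots_charpoly (S : Matrix n n ℂ) :
    S.charpoly.roots.card = Fintype.card n := by
  rw [← (IsAlgClosed.splits S.charpoly).natDegree_eq_card_roots,
    Matrix.charpoly_natDegree_eq_dim]

/-- Every eigenvalue satisfies `z² = -c`, so all have modulus `√c`: the equality case of
Cauchy–Schwarz. -/
theorem sum_norm_roots_charpoly_of_mul_self {S : Matrix n n ℂ} {c : ℝ}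
    (hS : S * S = (-c : ℂ) • 1) (hc : 0 ≤ c) :
    (S.charpoly.roots.map fun z : ℂ => ‖z‖).sum = Fintype.card n * √c := by
  have h : ∀ z ∈ S.charpoly.roots, ‖z‖ = √c := by
    intro z hz
    obtain ⟨v, hv, h⟩ := Matrix.exists_mulVec_eq_smul_of_mem_roots_charpoly hz
    have h2 : (z * z) • v = (-c : ℂ) • v := by
      calc (z * z) • v = S.mulVec (S.mulVec v) := by rw [h, Matrix.mulVec_smul, h, smul_smul]
        _ = _ := by rw [Matrix.mulVec_mulVec, hS, Matrix.smul_mulVec, Matrix.one_mulVec]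
    have h3 : z * z = -c := smul_left_injective ℂ hv h2
    have h4 : ‖z‖ * ‖z‖ = c := by
      rw [← norm_mul, h3, norm_neg, Complex.norm_real, Real.norm_of_nonneg hc]
    rw [← h4, Real.sqrt_mul_self (norm_nonneg z)]
  rw [Multiset.map_congr rfl h, Multiset.map_const', Multiset.sum_replicate,
    Matrix.card_roots_charpoly, nsmul_eq_mul]

/-- Diagonalising the Hermitian matrix `iS` shows that the roots have moduli `|ev i|`, whose squares
sum to the squared Frobenius norm; Cauchy–Schwarz finishes. For a skew-adjacency matrix that norm
does not depend on the orientation. -/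
theorem sum_norm_roots_charpoly_le {S : Matrix n n ℂ} (hS : S.conjTranspose = -S) :
    (S.charpoly.roots.map fun z : ℂ => ‖z‖).sum ≤
      √(Fintype.card n * ∑ i, ∑ j, ‖S i j‖ ^ 2) := by
  have hH : (Complex.I • S).IsHermitian := by
    rw [Matrix.IsHermitian, Matrix.conjTranspose_smul, hS]
    simp
  set U : Matrix n n ℂ := (hH.eigenvectorUnitary : Matrix n n ℂ)
  set ev := hH.eigenvalues
  have hUU : star U * U = 1 := Unitary.coe_star_mul_self hH.eigenvectorUnitary
  have hD : Complex.I • S = U * Matrix.diagonal (fun i => (ev i : ℂ)) * star U := by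
    have := hH.spectral_theorem
    rw [Unitary.conjStarAlgAut_apply] at this
    exact this
  have hS' : S = U * Matrix.diagonal (fun i => -Complex.I * ev i) * star U := by
    have h1 : Matrix.diagonal (fun i => -Complex.I * (ev i : ℂ)) =
        (-Complex.I) • Matrix.diagonal (fun i => (ev i : ℂ)) := by
      ext i j; by_cases h : i = j <;> simp [Matrix.diagonal, h]
    rw [h1, Matrix.mul_smul, Matrix.smul_mul, ← hD, smul_smul]
    simp
  have hroots : S.charpoly.roots = Finset.univ.val.map fun i => -Complex.I * (ev i : ℂ) := by
    rw [hS', Matrix.charpoly_mul_comm, ← Matrix.mul_assoc, hUU, Matrix.one_mul,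
      Matrix.charpoly_diagonal, Polynomial.roots_prod]
    · simp only [Polynomial.roots_X_sub_C, Multiset.bind_singleton]
    · exact Finset.prod_ne_zero_iff.2 fun i _ => Polynomial.X_sub_C_ne_zero _
  have hsum : (S.charpoly.roots.map fun z : ℂ => ‖z‖).sum = ∑ i, |ev i| := by
    rw [hroots, Multiset.map_map]
    simp only [Function.comp_def, norm_mul, norm_neg, Complex.norm_I, Complex.norm_real,
      Real.norm_eq_abs, one_mul]
    rfl
  have htr : ∑ i, ∑ j, ‖S i j‖ ^ 2 = ∑ i, |ev i| ^ 2 := by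
    have h1 : (S * S.conjTranspose).trace = ((∑ i, ∑ j, ‖S i j‖ ^ 2 : ℝ) : ℂ) := by
      simp [Matrix.trace, Matrix.mul_apply, Complex.mul_conj, Complex.normSq_eq_norm_sq]
    have h2 : (S * S.conjTranspose).trace = ((∑ i, |ev i| ^ 2 : ℝ) : ℂ) := by
      have : S * S.conjTranspose = (Complex.I • S) * (Complex.I • S) := by
        rw [hS, smul_mul_smul_comm]; simp
      rw [this, hD]
      have : U * Matrix.diagonal (fun i => (ev i : ℂ)) * star U *
          (U * Matrix.diagonal (fun i => (ev i : ℂ)) * star U) =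
          U * (Matrix.diagonal (fun i => (ev i : ℂ)) * Matrix.diagonal (fun i => (ev i : ℂ))) *
            star U := by
        simp only [Matrix.mul_assoc]
        rw [← Matrix.mul_assoc (star U) U, hUU, Matrix.one_mul]
      rw [this, Matrix.trace_mul_comm, ← Matrix.mul_assoc, hUU, Matrix.one_mul,
        Matrix.diagonal_mul_diagonal, Matrix.trace_diagonal]
      simp [← sq, sq_abs]
    exact_mod_cast h1.symm.trans h2
  rw [hsum, htr]
  refine Real.le_sqrt_of_sq_le ?_
  simpa using sq_sum_le_card_mul_sum_sq (s := (Finset.univ : Finset n)) (f := fun i => |ev i|)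

end SkewEnergy

theorem conjTranspose_skewAdjacency {V : Type*} {G : SimpleGraph V} (σ : GraphOrientation G) :
    (skewAdjacency σ).conjTranspose = -skewAdjacency σ := by
  ext u v
  have := σ.not_both u v
  by_cases h : σ.dir u v <;> by_cases h' : σ.dir v u <;> simp_all [skewAdjacency]

theorem norm_skewAdjacency_apply_sq {V : Type*} {G : SimpleGraph V} [DecidableRel G.Adj]
    (σ : GraphOrientation G) (u v : V) :
    ‖skewAdjacency σ u v‖ ^ 2 = if G.Adj u v then 1 else 0 := by
  have h1 := σ.adj_of_dir u v
  have h2 := σ.adj_of_dir v u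
  have h3 := σ.dir_or_dir u v
  have h4 := G.adj_comm u v
  by_cases h : σ.dir u v <;> by_cases h' : σ.dir v u <;> by_cases h'' : G.Adj u v <;>
    simp_all [skewAdjacency]

theorem isGreatest_skewEnergy_hypercube (d : ℕ) :
    IsGreatest (Set.range fun σ : GraphOrientation (hypercube d) => skewEnergy σ)
      (2 ^ d * √(d : ℝ)) := by
  constructor
  · refine ⟨hypercubeOrientation d, ?_⟩
    simp only [skewEnergy, skewAdjacency_hypercubeOrientation]
    rw [sum_norm_roots_charpoly_of_mul_self (c := d) (by simpa using hypercubeSkew_mul_self d)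
      (Nat.cast_nonneg d)]
    simp
  · rintro _ ⟨σ, rfl⟩
    refine (sum_norm_roots_charpoly_le (conjTranspose_skewAdjacency σ)).trans ?_
    have h : ∀ x : Fin d → Bool, ∑ y, (if (hypercube d).Adj x y then (1 : ℝ) else 0) = d := by
      intro x
      rw [Finset.sum_boole, ← SimpleGraph.neighborFinset_eq_filter,
        SimpleGraph.card_neighborFinset_eq_degree, hypercube_degree]
    simp only [norm_skewAdjacency_apply_sq, h]
    refine le_of_eq ?_
    simp only [Fintype.card_fun, Fintype.card_bool, Fintype.card_fin, Finset.sum_const,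
      Finset.card_univ, nsmul_eq_mul, Nat.cast_pow, Nat.cast_ofNat, ← mul_assoc]
    rw [Real.sqrt_mul (by positivity), Real.sqrt_mul_self (by positivity)]

/-! ### Joint spectral resolution of commuting Hermitian involutions -/

theorem sum_half_one_add_smul {R : Type*} [Ring R] [Algebra ℂ R] (T : R) :
    ∑ s : ℤˣ, (1 / 2 : ℂ) • (1 + ((s : ℤ) : ℂ) • T) = 1 := by
  rw [show (Finset.univ : Finset ℤˣ) = {1, -1} from rfl, Finset.sum_pair (by decide)]
  simp only [Units.val_one, Units.val_neg, Int.cast_one, Int.cast_neg, ← smul_add]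
  rw [add_add_add_comm, ← add_smul, add_neg_cancel, zero_smul, add_zero, ← two_smul ℂ, smul_smul]
  norm_num

theorem half_one_add_smul_mul_self {R : Type*} [Ring R] [Algebra ℂ R] {T : R} (hT : T * T = 1)
    (s : ℤˣ) :
    ((1 / 2 : ℂ) • (1 + ((s : ℤ) : ℂ) • T)) * ((1 / 2 : ℂ) • (1 + ((s : ℤ) : ℂ) • T)) =
      (1 / 2 : ℂ) • (1 + ((s : ℤ) : ℂ) • T) := by
  have hs : ((s : ℤ) : ℂ) * ((s : ℤ) : ℂ) = 1 := by
    rcases Int.units_eq_one_or s with h | h <;> simp [h]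
  rw [smul_mul_smul_comm, add_mul, one_mul, mul_add, mul_one, smul_mul_smul_comm, hs, hT, one_smul,
    add_comm (((s : ℤ) : ℂ) • T) 1, ← two_smul ℂ, smul_smul]
  norm_num

/-- The parent POVM consists of the products over `v` of the spectral projections `(1 ± T v)/2`. -/
theorem exists_isPOVM_of_commute {κ V : Type*} [Fintype κ] [DecidableEq κ] [Fintype V]
    [DecidableEq V] {T : V → Matrix κ κ ℂ} (hH : ∀ v, (T v).IsHermitian)
    (hsq : ∀ v, T v * T v = 1) (hcomm : ∀ v w, T v * T w = T w * T v) :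
    ∃ Q : (V → ℤˣ) → Matrix κ κ ℂ, IsPOVM Q ∧ ∀ (v : V) (s : ℤˣ),
      ∑ a : V → ℤˣ with a v = s, Q a = (1 / 2 : ℂ) • (1 + ((s : ℤ) : ℂ) • T v) := by
  have hc : ∀ x ∈ Set.range T, ∀ y ∈ Set.range T, x * y = y * x := by
    rintro _ ⟨v, rfl⟩ _ ⟨w, rfl⟩
    exact hcomm v w
  have := Algebra.isMulCommutative_adjoin ℂ hc
  -- Products over `V` need commutativity, which holds inside the subalgebra generated by the `T v`.
  let : CommRing (Algebra.adjoin ℂ (Set.range T)) :=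
    { Subalgebra.toRing _ with mul_comm := fun a b => this.is_comm.comm a b }
  let t : V → Algebra.adjoin ℂ (Set.range T) :=
    fun v => ⟨T v, Algebra.subset_adjoin (Set.mem_range_self v)⟩
  have htsq : ∀ v, t v * t v = 1 := fun v => Subtype.ext (hsq v)
  let f : V → ℤˣ → Algebra.adjoin ℂ (Set.range T) :=
    fun v s => (1 / 2 : ℂ) • (1 + ((s : ℤ) : ℂ) • t v)
  have hfsum : ∀ v, ∑ s, f v s = 1 := fun v => sum_half_one_add_smul (t v)
  have hfsq : ∀ v s, f v s * f v s = f v s := fun v s => half_one_add_smul_mul_self (htsq v) s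
  have hfH : ∀ v s, (f v s : Matrix κ κ ℂ).IsHermitian := by
    intro v s
    change ((1 / 2 : ℂ) • (1 + ((s : ℤ) : ℂ) • T v)).conjTranspose =
      (1 / 2 : ℂ) • (1 + ((s : ℤ) : ℂ) • T v)
    simp only [Matrix.conjTranspose_smul, Matrix.conjTranspose_add, Matrix.conjTranspose_one,
      (hH v).eq]
    simp
  have hprodH : ∀ (a : V → ℤˣ) (S : Finset V),
      ((∏ v ∈ S, f v (a v) : Algebra.adjoin ℂ (Set.range T)) : Matrix κ κ ℂ).IsHermitian := by
    intro a S
    induction S using Finset.induction_on with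
    | empty => simp
    | insert v S hv ih =>
      rw [Finset.prod_insert hv]
      change ((f v (a v) : Matrix κ κ ℂ) * _).conjTranspose = (f v (a v) : Matrix κ κ ℂ) * _
      rw [Matrix.conjTranspose_mul, ih.eq, (hfH _ _).eq]
      exact congrArg Subtype.val (mul_comm (∏ v ∈ S, f v (a v)) (f v (a v)))
  refine ⟨fun a => ((∏ v, f v (a v) : Algebra.adjoin ℂ (Set.range T)) : Matrix κ κ ℂ),
    ⟨fun a => ?_, ?_⟩, fun v s => ?_⟩
  -- A Hermitian idempotent `P` equals `Pᴴ P`, hence is positive semidefinite.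
  · have h1 : (∏ v, f v (a v)) * ∏ v, f v (a v) = ∏ v, f v (a v) := by
      rw [← Finset.prod_mul_distrib]
      exact Finset.prod_congr rfl fun v _ => hfsq v (a v)
    have h2 : ((∏ v, f v (a v) : Algebra.adjoin ℂ (Set.range T)) : Matrix κ κ ℂ) =
        ((∏ v, f v (a v) : Algebra.adjoin ℂ (Set.range T)) : Matrix κ κ ℂ).conjTranspose *
        ((∏ v, f v (a v) : Algebra.adjoin ℂ (Set.range T)) : Matrix κ κ ℂ) := by
      rw [(hprodH a univ).eq]
      exact (congrArg Subtype.val h1).symm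
    beta_reduce
    rw [h2]
    exact Matrix.posSemidef_conjTranspose_mul_self _
  · have h : ∑ a : V → ℤˣ, ∏ v, f v (a v) = 1 := by
      rw [← Fintype.piFinset_univ, ← Finset.prod_univ_sum]
      exact Finset.prod_eq_one fun v _ => hfsum v
    have := congrArg (Subalgebra.val _) h
    rwa [map_sum, map_one] at this
  · have h : ∑ a : V → ℤˣ with a v = s, ∏ w, f w (a w) = f v s := by
      -- The outcomes with `a v = s` form a box, so the sum factors; every factor other than the one
      -- at `v` is `1`.
      have : (Finset.univ.filter fun a : V → ℤˣ => a v = s) =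
          Fintype.piFinset fun w => if w = v then {s} else Finset.univ := by
        ext a
        simp only [Finset.mem_filter, Finset.mem_univ, true_and, Fintype.mem_piFinset]
        refine ⟨fun h w => ?_, fun h => by simpa using h v⟩
        split_ifs with hw
        · simp [hw, h]
        · exact Finset.mem_univ _
      rw [this, ← Finset.prod_univ_sum, Finset.prod_eq_single v]
      · simp
      · intro w _ hw
        rw [if_neg hw, hfsum]
      · simp
    have := congrArg (Subalgebra.val _) h
    rwa [map_sum] at this

/-! ### Joint measurability from a reference family -/

open Kronecker in
/-- If two families of binary observables have the same anti-commutativity graph, the second one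
acting on a space with a basis vector at which all of its expectations equal `η`, then the noisy
version of the first one at level `η` is jointly measurable. -/
theorem isJointlyMeasurable_of_reference {ι κ V : Type*} [Fintype ι] [DecidableEq ι] [Fintype κ]
    [DecidableEq κ] [Fintype V] [DecidableEq V] {G : SimpleGraph V} {A : V → Matrix ι ι ℂ}
    {B : V → Matrix κ κ ℂ} (hA : HasAnticommutativityGraph G A)
    (hB : HasAnticommutativityGraph G B) (hG : ∀ v, ∃ w, G.Adj v w) {η : ℝ} {k : κ}
    (hk : ∀ v, B v k k = η) : IsJointlyMeasurable fun v => noisyEffect η (A v) := by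
  obtain ⟨Q, ⟨hQpos, hQsum⟩, hQ⟩ := exists_isPOVM_of_commute (T := fun v => A v ⊗ₖ B v)
    (fun v => by
      rw [Matrix.IsHermitian, Matrix.conjTranspose_kronecker, (hA.isHermitian v).eq,
        (hB.isHermitian v).eq])
    (fun v => by rw [← Matrix.mul_kronecker_mul, hA.mul_self, hB.mul_self, Matrix.one_kronecker_one])
    (fun v w => by
      rw [← Matrix.mul_kronecker_mul, ← Matrix.mul_kronecker_mul]
      by_cases h : G.Adj v w
      · rw [(hA.adj_iff v w).1 h, (hB.adj_iff v w).1 h]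
        ext ⟨i, j⟩ ⟨i', j'⟩
        simp [Matrix.kroneckerMap_apply]
      · rw [hA.commute v w h, hB.commute v w h])
  -- Compression to the subspace `ℂ^ι ⊗ e_k`.
  refine ⟨fun a => (Q a).submatrix (fun i => (i, k)) (fun i => (i, k)),
    ⟨fun a => (hQpos a).submatrix _, ?_⟩, fun v s => ?_⟩
  · ext i j
    have := congrFun₂ hQsum (i, k) (j, k)
    rw [Matrix.sum_apply] at this
    simp only [Matrix.sum_apply, Matrix.submatrix_apply, this]
    simp [Matrix.one_apply]
  · obtain ⟨w, hw⟩ := hG v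
    beta_reduce
    rw [noisyEffect_eq_of_anticommute η (A v) (A w) (hA.mul_self w) ((hA.adj_iff v w).1 hw)]
    ext i j
    have := congrFun₂ (hQ v s) (i, k) (j, k)
    rw [Matrix.sum_apply] at this
    simp only [Matrix.sum_apply, Matrix.submatrix_apply, this]
    simp [Matrix.one_apply, Matrix.kroneckerMap_apply, hk, mul_comm]

/-! ### The bound from pairwise anti-commuting observables -/

/-- A jointly measurable noise level of a family containing `d` pairwise anti-commuting binary
observables is at most `1 / √d`. -/
theorem le_of_isJointlyMeasurable_of_anticomm {ι V : Type*} [Fintype ι] [DecidableEq ι]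
    [Nonempty ι] [Fintype V] [DecidableEq V] {A : V → Matrix ι ι ℂ} {d : ℕ} (hd : 2 ≤ d)
    (e : Fin d → V) (hH : ∀ v, (A v).IsHermitian) (hsq : ∀ v, A v * A v = 1)
    (hanti : ∀ i j, i ≠ j → A (e i) * A (e j) = -(A (e j) * A (e i))) {η : ℝ}
    (hη : IsJointlyMeasurable fun v => noisyEffect η (A v)) : η ≤ 1 / √(d : ℝ) := by
  obtain ⟨E, ⟨hpos, hsum⟩, hmarg⟩ := hη
  have hd0 : (0 : ℝ) < d := by exact_mod_cast (by omega : 0 < d)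
  have hr : (0 : ℝ) < √d := Real.sqrt_pos.2 hd0
  have hmargA : ∀ i, ∑ a : V → ℤˣ, ((a (e i) : ℤ) : ℂ) • E a = (η : ℂ) • A (e i) := by
    intro i
    -- An anti-commuting partner makes `A (e i)` traceless, which removes the trace term from the
    -- noise.
    obtain ⟨j, hj⟩ : ∃ j : Fin d, i ≠ j := by
      have : Nontrivial (Fin d) := Fin.nontrivial_iff_two_le.2 hd
      exact (exists_ne i).imp fun _ h => h.symm
    rw [← Finset.sum_fiberwise univ (fun a : V → ℤˣ => a (e i))]
    have : ∀ s : ℤˣ, ∑ a : V → ℤˣ with a (e i) = s, ((a (e i) : ℤ) : ℂ) • E a =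
        ((s : ℤ) : ℂ) • ((1 / 2 : ℂ) • (1 + ((s : ℤ) : ℂ) • ((η : ℂ) • A (e i)))) := by
      intro s
      rw [← noisyEffect_eq_of_anticommute η _ _ (hsq (e j)) (hanti i j hj),
        show noisyEffect η (A (e i)) s = _ from hmarg (e i) s, Finset.smul_sum]
      refine Finset.sum_congr rfl fun a ha => ?_
      rw [(Finset.mem_filter.1 ha).2]
    simp only [this]
    rw [show (Finset.univ : Finset ℤˣ) = {1, -1} from rfl, Finset.sum_pair (by decide)]
    simp only [Units.val_one, Units.val_neg, Int.cast_one, Int.cast_neg]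
    module
  have htr : ∀ a : V → ℤˣ,
      (∑ i, (((a (e i) : ℤ) : ℂ) • (E a * A (e i))).trace) ≤ ((√(d : ℝ) : ℝ) : ℂ) * (E a).trace := by
    intro a
    set H : Matrix ι ι ℂ := ∑ i, ((a (e i) : ℤ) : ℂ) • A (e i) with hHdef
    have hHH : H * H = (d : ℂ) • 1 := by
      rw [hHdef, sum_smul_sq_of_anticomm (ε := 1) (fun i => by rw [hsq, one_smul]) hanti]
      congr 1
      have : ∀ s : ℤˣ, ((s : ℤ) : ℂ) * ((s : ℤ) : ℂ) = 1 := by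
        intro s
        rcases Int.units_eq_one_or s with h | h <;> simp [h]
      simp [this]
    have hHherm : H.conjTranspose = H := by
      simp [hHdef, Matrix.conjTranspose_sum, Matrix.conjTranspose_smul, (hH _).eq]
    -- Since `H² = d`, the matrix `Y = √d - H` satisfies `Y² = 2√d Y`. Hence `tr (Y E Y) = 2√d tr (E
    -- Y)`, and positivity of the left side gives `tr (E H) ≤ √d tr E` without a square root of `Y`.
    set Y : Matrix ι ι ℂ := ((√(d : ℝ) : ℝ) : ℂ) • 1 - H with hY
    have hYherm : Y.conjTranspose = Y := by
      simp [hY, Matrix.conjTranspose_sub, Matrix.conjTranspose_smul, hHherm]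
    have hsqrt : ((√(d : ℝ) : ℝ) : ℂ) * ((√(d : ℝ) : ℝ) : ℂ) = d := by
      exact_mod_cast congrArg (fun x : ℝ => (x : ℂ)) (Real.mul_self_sqrt hd0.le)
    have hYY : Y * Y = (2 * ((√(d : ℝ) : ℝ) : ℂ)) • Y := by
      simp only [hY, mul_sub, sub_mul, smul_mul_smul_comm, hsqrt, hHH, Matrix.smul_mul,
        Matrix.mul_smul, Matrix.one_mul, Matrix.mul_one, smul_sub, smul_smul, mul_assoc]
      module
    have h1 : 0 ≤ (2 * ((√(d : ℝ) : ℝ) : ℂ)) * (((√(d : ℝ) : ℝ) : ℂ) * (E a).trace - (E a * H).trace) := by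
      have h2 : (Y * E a * Y.conjTranspose).trace =
          (2 * ((√(d : ℝ) : ℝ) : ℂ)) * (((√(d : ℝ) : ℝ) : ℂ) * (E a).trace - (E a * H).trace) := by
        rw [hYherm, Matrix.mul_assoc, Matrix.trace_mul_comm, Matrix.mul_assoc, hYY]
        simp [hY, mul_sub, Matrix.trace_sub]
      rw [← h2]
      exact ((hpos a).mul_mul_conjTranspose_same Y).trace_nonneg
    have h3 : (0 : ℂ) < 2 * ((√(d : ℝ) : ℝ) : ℂ) := by
      exact_mod_cast (by positivity : (0 : ℝ) < 2 * √(d : ℝ))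
    have h4 := mul_nonneg (inv_nonneg.2 h3.le) h1
    rw [inv_mul_cancel_left₀ h3.ne', sub_nonneg] at h4
    refine le_trans (le_of_eq ?_) h4
    simp [hHdef, Finset.mul_sum, Matrix.trace_sum]
  have hfin := Finset.sum_le_sum fun a (_ : a ∈ (univ : Finset (V → ℤˣ))) => htr a
  rw [Finset.sum_comm, ← Finset.mul_sum, ← Matrix.trace_sum, hsum, Matrix.trace_one] at hfin
  have hleft : ∀ i, ∑ a : V → ℤˣ, (((a (e i) : ℤ) : ℂ) • (E a * A (e i))).trace =
      η * Fintype.card ι := by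
    intro i
    rw [← Matrix.trace_sum]
    simp_rw [← Matrix.smul_mul]
    rw [← Finset.sum_mul, hmargA, Matrix.smul_mul, hsq, Matrix.trace_smul, Matrix.trace_one,
      smul_eq_mul]
  simp only [hleft, Finset.sum_const, Finset.card_univ, Fintype.card_fin, nsmul_eq_mul] at hfin
  have hfin' : (d : ℝ) * (η * Fintype.card ι) ≤ √d * Fintype.card ι := by exact_mod_cast hfin
  have hcard : (0 : ℝ) < Fintype.card ι := by exact_mod_cast Fintype.card_pos
  rw [← mul_assoc] at hfin'
  have h5 := le_of_mul_le_mul_right hfin' hcard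
  rw [le_div_iff₀ hr]
  have h6 : √(d : ℝ) * (η * √d) ≤ √d * 1 := by
    calc √(d : ℝ) * (η * √d) = (√d * √d) * η := by ring
      _ = d * η := by rw [Real.mul_self_sqrt hd0.le]
      _ ≤ _ := by rwa [mul_one]
  exact le_of_mul_le_mul_left h6 hr

/-! ### Constructing families of binary observables -/

/-- On a nonzero space two involutions cannot both commute and anti-commute: their product would be
both zero and invertible. -/
theorem HasAnticommutativityGraph.of_anticomm {ι V : Type*} [Fintype ι] [DecidableEq ι]
    [Nonempty ι] {G : SimpleGraph V} {A : V → Matrix ι ι ℂ} (hH : ∀ v, (A v).IsHermitian)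
    (hsq : ∀ v, A v * A v = 1) (hadj : ∀ v w, G.Adj v w → A v * A w = -(A w * A v))
    (hcomm : ∀ v w, ¬ G.Adj v w → A v * A w = A w * A v) : HasAnticommutativityGraph G A where
  isHermitian := hH
  mul_self := hsq
  adj_iff v w := by
    refine ⟨hadj v w, fun h => ?_⟩
    by_contra hn
    rw [hcomm v w hn] at h
    have h0 : A w * A v = 0 := by
      ext i j
      exact self_eq_neg.1 (congrFun₂ h i j)
    have h1 : (1 : Matrix ι ι ℂ) = 0 := by
      calc (1 : Matrix ι ι ℂ) = A w * (A v * A v) * A w := by rw [hsq, Matrix.mul_one, hsq]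
        _ = A w * A v * (A v * A w) := by simp only [Matrix.mul_assoc]
        _ = 0 := by rw [h0, Matrix.zero_mul]
    exact one_ne_zero h1
  commute := hcomm

theorem HasAnticommutativityGraph.submatrix {ι κ V : Type*} [Fintype ι] [DecidableEq ι]
    [Fintype κ] [DecidableEq κ] [Nonempty κ] {G : SimpleGraph V} {A : V → Matrix ι ι ℂ}
    (hA : HasAnticommutativityGraph G A) (f : κ ≃ ι) :
    HasAnticommutativityGraph G fun v => (A v).submatrix f f := by
  refine .of_anticomm (fun v => (hA.isHermitian v).submatrix f) (fun v => ?_) (fun v w h => ?_)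
    fun v w h => ?_
  · rw [Matrix.submatrix_mul_equiv, hA.mul_self, Matrix.submatrix_one_equiv]
  · rw [Matrix.submatrix_mul_equiv, Matrix.submatrix_mul_equiv, (hA.adj_iff v w).1 h]
    rfl
  · rw [Matrix.submatrix_mul_equiv, Matrix.submatrix_mul_equiv, hA.commute v w h]

/-! ### Majorana operators attached to the vertices of the hypercube -/

theorem mul_mul_mul_of_anticomm {R : Type*} [Ring R] {a b a' b' : R} (h : a' * b = -(b * a')) :
    a * b * (a' * b') = -((a * a') * (b * b')) := by
  have h' : b * a' = -(a' * b) := by rw [h, neg_neg]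
  calc a * b * (a' * b') = a * (b * a') * b' := by simp only [mul_assoc]
    _ = _ := by rw [h']; simp only [mul_neg, neg_mul, mul_assoc]

/-- An enumeration of the vertices of the hypercube, which index the fermionic modes. -/
noncomputable abbrev modeEquiv (d : ℕ) :
    (Fin d → Bool) ≃ Fin (Fintype.card (Fin d → Bool)) := Fintype.equivFin _

/-- The Hermitian Majorana operator at a vertex. -/
noncomputable def majorana (d : ℕ) (u : Fin d → Bool) :
    Matrix (Fin (Fintype.card (Fin d → Bool)) → Bool)
      (Fin (Fintype.card (Fin d → Bool)) → Bool) ℂ :=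
  signedFlip (modeEquiv d u) (Finset.Iio (modeEquiv d u))

/-- The skew-Hermitian partner of `majorana`. -/
noncomputable def majoranaPartner (d : ℕ) (u : Fin d → Bool) :
    Matrix (Fin (Fintype.card (Fin d → Bool)) → Bool)
      (Fin (Fintype.card (Fin d → Bool)) → Bool) ℂ :=
  signedFlip (modeEquiv d u) (Finset.Iic (modeEquiv d u))

/-- The partners rotated by the orthogonal matrix `hypercubeSkew d / √d`. -/
noncomputable def rotatedPartner (d : ℕ) (v : Fin d → Bool) :
    Matrix (Fin (Fintype.card (Fin d → Bool)) → Bool)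
      (Fin (Fintype.card (Fin d → Bool)) → Bool) ℂ :=
  ∑ u, (hypercubeSkew d u v / ((√(d : ℝ) : ℝ) : ℂ)) • majoranaPartner d u

section HypercubeMajorana

variable {d : ℕ}

theorem majorana_mul_self (u : Fin d → Bool) : majorana d u * majorana d u = 1 := by
  rw [majorana, signedFlip_mul_self]; simp

theorem majorana_anticomm {u v : Fin d → Bool} (h : u ≠ v) :
    majorana d u * majorana d v = -(majorana d v * majorana d u) :=
  signedFlip_Iio_anticomm ((modeEquiv d).injective.ne h)

theorem conjTranspose_majorana (u : Fin d → Bool) :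
    (majorana d u).conjTranspose = majorana d u := by
  simp [majorana, conjTranspose_signedFlip]

theorem majorana_rotatedPartner_anticomm (u v : Fin d → Bool) :
    majorana d u * rotatedPartner d v = -(rotatedPartner d v * majorana d u) := by
  rw [rotatedPartner, Finset.mul_sum, Finset.sum_mul, ← Finset.sum_neg_distrib]
  refine Finset.sum_congr rfl fun w _ => ?_
  rw [Matrix.mul_smul, Matrix.smul_mul, majorana, majoranaPartner, signedFlip_Iio_Iic_anticomm,
    smul_neg]

theorem conjTranspose_rotatedPartner (v : Fin d → Bool) :
    (rotatedPartner d v).conjTranspose = -rotatedPartner d v := by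
  rw [rotatedPartner, Matrix.conjTranspose_sum, ← Finset.sum_neg_distrib]
  refine Finset.sum_congr rfl fun w _ => ?_
  rw [Matrix.conjTranspose_smul, majoranaPartner, conjTranspose_signedFlip, star_div₀,
    star_hypercubeSkew_apply]
  simp

/-- Orthonormality of the columns of `S/√d`, from `SᵀS = -S² = d`. -/
theorem sum_hypercubeSkew_div_sqrt (hd : 0 < d) (v w : Fin d → Bool) :
    ∑ u, hypercubeSkew d u v / ((√(d : ℝ) : ℝ) : ℂ) *
      (hypercubeSkew d u w / ((√(d : ℝ) : ℝ) : ℂ)) = if v = w then 1 else 0 := by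
  have hsqrt : ((√(d : ℝ) : ℝ) : ℂ) * ((√(d : ℝ) : ℝ) : ℂ) = d := by
    exact_mod_cast congrArg (fun x : ℝ => (x : ℂ)) (Real.mul_self_sqrt (Nat.cast_nonneg d))
  have hd0 : (d : ℂ) ≠ 0 := by exact_mod_cast hd.ne'
  have h := congrFun₂ (hypercubeSkew_mul_self d) v w
  rw [Matrix.mul_apply] at h
  simp only [hypercubeSkew_swap _ v, neg_mul, Finset.sum_neg_distrib, Matrix.smul_apply,
    Matrix.one_apply, smul_eq_mul, neg_inj] at h
  simp only [div_mul_div_comm, hsqrt, ← Finset.sum_div, h]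
  split_ifs <;> simp [hd0]

theorem rotatedPartner_anticommutator (hd : 0 < d) (v w : Fin d → Bool) :
    rotatedPartner d v * rotatedPartner d w + rotatedPartner d w * rotatedPartner d v =
      (if v = w then -2 else 0 : ℂ) • 1 := by
  have h := sum_smul_mul_sum_smul_of_anticomm (A := majoranaPartner d) (ε := -1)
    (fun u => signedFlip_Iic_mul_self _)
    (fun u u' h => signedFlip_Iic_anticomm ((modeEquiv d).injective.ne h))
    (fun u => hypercubeSkew d u v / ((√(d : ℝ) : ℝ) : ℂ))
    (fun u => hypercubeSkew d u w / ((√(d : ℝ) : ℝ) : ℂ))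
  rw [sum_hypercubeSkew_div_sqrt hd] at h
  rw [rotatedPartner, rotatedPartner, h]
  split_ifs <;> norm_num

theorem rotatedPartner_mul_self (hd : 0 < d) (v : Fin d → Bool) :
    rotatedPartner d v * rotatedPartner d v = -1 := by
  have h := rotatedPartner_anticommutator hd v v
  rw [if_pos rfl, ← two_smul ℂ, show (-2 : ℂ) = 2 * (-1) by norm_num, mul_smul] at h
  simpa using smul_right_injective _ (two_ne_zero' ℂ) h

theorem rotatedPartner_anticomm (hd : 0 < d) {v w : Fin d → Bool} (h : v ≠ w) :
    rotatedPartner d v * rotatedPartner d w = -(rotatedPartner d w * rotatedPartner d v) := by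
  have := rotatedPartner_anticommutator hd v w
  rwa [if_neg h, zero_smul, add_eq_zero_iff_eq_neg] at this

/-- The Hermitian bilinears in the Majorana operators, with the sign of the edge. -/
noncomputable def majoranaBilinear (d : ℕ) (u v : Fin d → Bool) :
    Matrix (Fin (Fintype.card (Fin d → Bool)) → Bool)
      (Fin (Fintype.card (Fin d → Bool)) → Bool) ℂ :=
  (-hypercubeSkew d u v) • (majorana d u * rotatedPartner d v)

theorem majoranaBilinear_isHermitian (u v : Fin d → Bool) :
    (majoranaBilinear d u v).IsHermitian := by
  rw [Matrix.IsHermitian, majoranaBilinear, Matrix.conjTranspose_smul, Matrix.conjTranspose_mul,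
    conjTranspose_rotatedPartner, conjTranspose_majorana, star_neg, star_hypercubeSkew_apply,
    majorana_rotatedPartner_anticomm, Matrix.neg_mul]

theorem majoranaBilinear_mul (u v u' v' : Fin d → Bool) :
    majoranaBilinear d u v * majoranaBilinear d u' v' =
      (hypercubeSkew d u v * hypercubeSkew d u' v') •
        -((majorana d u * majorana d u') * (rotatedPartner d v * rotatedPartner d v')) := by
  rw [majoranaBilinear, majoranaBilinear, smul_mul_smul_comm, neg_mul_neg,
    mul_mul_mul_of_anticomm (majorana_rotatedPartner_anticomm u' v)]

theorem majoranaBilinear_mul_self (hd : 0 < d) {u v : Fin d → Bool} (h : (hypercube d).Adj u v) :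
    majoranaBilinear d u v * majoranaBilinear d u v = 1 := by
  rw [majoranaBilinear_mul, majorana_mul_self, rotatedPartner_mul_self hd]
  rcases hypercubeSkew_apply_of_adj h with h | h <;> simp [h]

theorem majoranaBilinear_anticomm_of_ne_right (hd : 0 < d) (u : Fin d → Bool)
    {v v' : Fin d → Bool} (h : v ≠ v') :
    majoranaBilinear d u v * majoranaBilinear d u v' =
      -(majoranaBilinear d u v' * majoranaBilinear d u v) := by
  rw [majoranaBilinear_mul, majoranaBilinear_mul, rotatedPartner_anticomm hd h,
    mul_comm (hypercubeSkew d u v)]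
  simp only [Matrix.mul_neg, smul_neg, neg_neg]

theorem majoranaBilinear_anticomm_of_ne_left {u u' : Fin d → Bool} (v : Fin d → Bool)
    (h : u ≠ u') :
    majoranaBilinear d u v * majoranaBilinear d u' v =
      -(majoranaBilinear d u' v * majoranaBilinear d u v) := by
  rw [majoranaBilinear_mul, majoranaBilinear_mul, majorana_anticomm h,
    mul_comm (hypercubeSkew d u v)]
  simp only [Matrix.neg_mul, smul_neg, neg_neg]

theorem majoranaBilinear_comm_of_ne (hd : 0 < d) {u v u' v' : Fin d → Bool} (hu : u ≠ u')
    (hv : v ≠ v') :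
    majoranaBilinear d u v * majoranaBilinear d u' v' =
      majoranaBilinear d u' v' * majoranaBilinear d u v := by
  rw [majoranaBilinear_mul, majoranaBilinear_mul, majorana_anticomm hu,
    rotatedPartner_anticomm hd hv, mul_comm (hypercubeSkew d u v)]
  simp only [Matrix.neg_mul, Matrix.mul_neg, neg_neg]

theorem majorana_mul_majoranaPartner_apply (u w : Fin d → Bool) :
    (majorana d u * majoranaPartner d w) (fun _ => false) (fun _ => false) =
      if w = u then -1 else 0 := by
  rw [majorana, majoranaPartner, signedFlip_mul_apply]
  have h : ((fun _ => false : Fin (Fintype.card (Fin d → Bool)) → Bool) =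
      flipAt (modeEquiv d w) (flipAt (modeEquiv d u) fun _ => false)) ↔ w = u := by
    rw [eq_flipAt_iff, (flipAt_left_injective _).eq_iff, (modeEquiv d).injective.eq_iff, eq_comm]
  rw [if_congr h rfl rfl]
  split_ifs with h1 h2
  · simp [bitSign]
  · subst h1; simp at h2
  · rfl

/-- Only the component of the rotated partner along `u` has a vacuum expectation with `majorana d
u`, namely `-1`. Its coefficient `S_uv/√d` meets the prefactor `-S_uv`, and `S_uv² = 1` on edges. -/
theorem majoranaBilinear_apply {u v : Fin d → Bool} (h : (hypercube d).Adj u v) :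
    majoranaBilinear d u v (fun _ => false) (fun _ => false) = ((1 / √(d : ℝ) : ℝ) : ℂ) := by
  rw [majoranaBilinear, rotatedPartner, Finset.mul_sum, Matrix.smul_apply, Matrix.sum_apply]
  simp only [Matrix.mul_smul, Matrix.smul_apply, majorana_mul_majoranaPartner_apply, smul_eq_mul,
    mul_ite, mul_zero, Finset.sum_ite_eq', Finset.mem_univ, if_true]
  rcases hypercubeSkew_apply_of_adj h with h | h <;> simp [h, neg_div]

end HypercubeMajorana

/-! ### The robustness of the line graph of the hypercube -/

/-- Flipping a bit changes parity, so the cube is bipartite and every edge has one even endpoint `u`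
and one odd endpoint `v`. Distinct edges can then meet only in `u` with `u` or `v` with `v`,
matching the two sets of Majorana operators. -/
theorem exists_endpoints_of_mem_edgeSet_hypercube {d : ℕ} (e : (hypercube d).edgeSet) :
    ∃ u v, (e : Sym2 (Fin d → Bool)) = s(u, v) ∧ (hypercube d).Adj u v ∧
      bitSign univ u = 1 ∧ bitSign univ v = -1 := by
  obtain ⟨e, he⟩ := e
  induction e using Sym2.ind with
  | _ x y =>
    rw [SimpleGraph.mem_edgeSet] at he
    obtain ⟨i, hi⟩ := (hypercube_adj_iff x y).1 he
    have hxy : bitSign univ y = -bitSign univ x := by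
      rw [hi, bitSign_flipAt]; simp
    rcases bitSign_eq univ x with hx | hx
    · exact ⟨x, y, rfl, he, hx, by rw [hxy, hx]⟩
    · exact ⟨y, x, Sym2.eq_swap, he.symm, by rw [hxy, hx, neg_neg], hx⟩

theorem exists_hasAnticommutativityGraph_lineGraph_hypercube {d : ℕ} (hd : 0 < d) :
    ∃ B : (hypercube d).edgeSet → Matrix (Fin (Fintype.card (Fin d → Bool)) → Bool)
        (Fin (Fintype.card (Fin d → Bool)) → Bool) ℂ,
      HasAnticommutativityGraph (hypercube d).lineGraph B ∧
      ∀ e, B e (fun _ => false) (fun _ => false) = ((1 / √(d : ℝ) : ℝ) : ℂ) := by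
  choose u v he hadj hu hv using exists_endpoints_of_mem_edgeSet_hypercube (d := d)
  have hne : ∀ e f, u e ≠ v f := by
    intro e f h
    have := hu e
    rw [h, hv f] at this
    norm_num at this
  have hline : ∀ e f, (hypercube d).lineGraph.Adj e f ↔
      ¬(u e = u f ∧ v e = v f) ∧ (u e = u f ∨ v e = v f) := by
    intro e f
    rw [SimpleGraph.lineGraph_adj_iff_exists, he e, he f]
    refine and_congr ?_ ?_
    · rw [ne_eq, ← Subtype.coe_inj, he e, he f, Sym2.eq_iff]
      simp [hne]
    · simp only [Sym2.mem_iff]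
      constructor
      · rintro ⟨x, rfl | rfl, h | h⟩
        · exact Or.inl h
        · exact absurd h (hne _ _)
        · exact absurd h.symm (hne _ _)
        · exact Or.inr h
      · rintro (h | h)
        · exact ⟨u e, Or.inl rfl, Or.inl h⟩
        · exact ⟨v e, Or.inr rfl, Or.inr h⟩
  refine ⟨fun e => majoranaBilinear d (u e) (v e), .of_anticomm
    (fun e => majoranaBilinear_isHermitian _ _)
    (fun e => majoranaBilinear_mul_self hd (hadj e)) (fun e f h => ?_) (fun e f h => ?_),
    fun e => majoranaBilinear_apply (hadj e)⟩
  · rw [hline] at h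
    rcases eq_or_ne (u e) (u f) with h1 | h1
    · rw [← h1]
      exact majoranaBilinear_anticomm_of_ne_right hd _ fun h2 => h.1 ⟨h1, h2⟩
    · rw [← h.2.resolve_left h1]
      exact majoranaBilinear_anticomm_of_ne_left _ h1
  · rw [hline] at h
    by_cases h1 : u e = u f
    · by_cases h2 : v e = v f
      · rw [h1, h2]
      · exact absurd ⟨fun h => h2 h.2, Or.inl h1⟩ h
    · by_cases h2 : v e = v f
      · exact absurd ⟨fun h => h1 h.1, Or.inr h2⟩ h
      · exact majoranaBilinear_comm_of_ne hd h1 h2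

theorem lineGraph_adj_of_common_endpoint {V : Type*} {G : SimpleGraph V} {x y z : V}
    (hy : G.Adj x y) (hz : G.Adj x z) (h : y ≠ z) :
    G.lineGraph.Adj ⟨s(x, y), hy⟩ ⟨s(x, z), hz⟩ := by
  rw [SimpleGraph.lineGraph_adj_iff_exists]
  refine ⟨fun h' => h ?_, x, Sym2.mem_mk_left x y, Sym2.mem_mk_left x z⟩
  exact Sym2.congr_right.1 (Subtype.ext_iff.1 h')

theorem hypercube_adj_flipAt {d : ℕ} (x : Fin d → Bool) (i : Fin d) :
    (hypercube d).Adj x (flipAt i x) :=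
  (hypercube_adj_iff _ _).2 ⟨i, rfl⟩

theorem exists_adj_lineGraph_hypercube {d : ℕ} (hd : 2 ≤ d) (e : (hypercube d).edgeSet) :
    ∃ f, (hypercube d).lineGraph.Adj e f := by
  obtain ⟨e, he⟩ := e
  induction e using Sym2.ind with
  | _ x y =>
    obtain ⟨i, rfl⟩ := (hypercube_adj_iff x y).1 he
    have : Nontrivial (Fin d) := Fin.nontrivial_iff_two_le.2 hd
    obtain ⟨j, hj⟩ := exists_ne i
    exact ⟨_, lineGraph_adj_of_common_endpoint he (hypercube_adj_flipAt x j)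
      fun h => hj (flipAt_left_injective x h).symm⟩

theorem isIncompatibilityRobustness_lineGraph_hypercube {d : ℕ} (hd : 2 ≤ d) :
    IsIncompatibilityRobustness (hypercube d).lineGraph (1 / √(d : ℝ)) := by
  obtain ⟨B, hB, hB0⟩ := exists_hasAnticommutativityGraph_lineGraph_hypercube
    (show 0 < d by omega)
  let f := (Fintype.equivFin (Fin (Fintype.card (Fin d → Bool)) → Bool)).symm
  refine ⟨⟨_, Fintype.card_pos, fun e => (B e).submatrix f f, ?_⟩, fun m hm A hA =>
    ⟨⟨⟨by positivity, ?_⟩, ?_⟩, ?_⟩⟩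
  · have : Nonempty (Fin (Fintype.card (Fin (Fintype.card (Fin d → Bool)) → Bool))) :=
      Fin.pos_iff_nonempty.1 Fintype.card_pos
    exact hB.submatrix f
  · exact div_le_one_of_le₀ (Real.one_le_sqrt.2 (by exact_mod_cast (by omega : 1 ≤ d)))
      (Real.sqrt_nonneg _)
  · exact isJointlyMeasurable_of_reference hA hB (exists_adj_lineGraph_hypercube hd) hB0
  · rintro η ⟨-, hη⟩
    have : Nonempty (Fin m) := Fin.pos_iff_nonempty.1 hm
    exact le_of_isJointlyMeasurable_of_anticomm hd
      -- The clique is the star of the `d` edges at the all-`false` vertex.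
      (fun i => ⟨s(fun _ => false, flipAt i fun _ => false), hypercube_adj_flipAt _ i⟩)
      hA.isHermitian hA.mul_self
      (fun i j hij => (hA.adj_iff _ _).1 (lineGraph_adj_of_common_endpoint _ _
        fun h => hij (flipAt_left_injective _ h))) hη

theorem mainTheorem9 (d : ℕ) (hd : 3 ≤ d) :
    Fintype.card (hypercube d).edgeSet = d * 2 ^ (d - 1) ∧
    IsIncompatibilityRobustness (hypercube d).lineGraph (1 / √(d : ℝ)) ∧
    IsGreatest (Set.range fun σ : GraphOrientation (hypercube d) => skewEnergy σ)
      (2 ^ d * √(d : ℝ)) := by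
  exact ⟨card_edgeSet_hypercube (by omega),
    isIncompatibilityRobustness_lineGraph_hypercube (by omega), isGreatest_skewEnergy_hypercube d⟩
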